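/- \textbf{Setting.} $\mathsf{GLP}$ is the propositional normal modal logic with a modality $[\alpha]$ for every ordinal $\alpha$ (and $\langle\alpha\rangle=\neg[\alpha]\neg$), axiomatized by all propositional tautologies and the schemata $[\alpha](\chi\to\psi)\to([\alpha]\chi\to[\alpha]\psi)$; $[\alpha]([\alpha]\chi\to\chi)\to[\alpha]\chi$; $\langle\alpha\rangle\psi\to[\beta]\langle\alpha\rangle\psi$ for $\alpha<\beta$; $[\alpha]\psi\to[\beta]\psi$ for $\alpha\le\beta$; with the rules modus ponens and $\psi/[\alpha]\psi$. A worm is a formula $\langle\alpha_1\rangle\cdots\langle\alpha_n\rangle\top$ with $n\ge 0$ and $\alpha_1,\dots,\alpha_n$ ordinals. For an ordinal $\xi$ and worms $A,B$ write $A<_\xi B$ if $\mathsf{GLP}\vdash B\to\langle\xi\rangle A$. Define $\Omega_\xi(A)$ by recursion on $<_\xi$: \[\Omega_\xi(A)=\sup\{\Omega_\xi(B)+1 : B \text{ a worm},\ B<_\xi A\},\qquad \sup\varnothing=0.\] For an ordinal $\eta>0$ let $\ell\eta$ be the exponent of the last term in the Cantor normal form of $\eta$, i.e. the unique $\beta$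 such that $\eta=\alpha+\omega^\beta$ for some $\alpha$; let $\ell 0=0$. \textbf{Theorem.} For every ordinal $\xi$ the relation $<_\xi$ on the class of all worms is well-founded and all the suprema above exist (so $\Omega_\xi(A)$ is a well-defined ordinal for every worm $A$), and for every worm $A$ and every ordinal $\xi$, \[\Omega_{\xi+1}(A)=\ell\,\Omega_\xi(A).\] -/

import Mathlib

universe u

namespace GLP

open Ordinal

/-- Formulas of propositional modal logic with propositional variables indexed by `ℕ` and one
modality `[α]` for every ordinal `α`. Falsum, implication and the boxes are primitive. -/
inductive Formula : Type (u + 1)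
  | var : ℕ → Formula
  | bot : Formula
  | imp : Formula → Formula → Formula
  | box : Ordinal.{u} → Formula → Formula

namespace Formula

/-- Negation `¬ φ := φ → ⊥`. -/
def neg (φ : Formula.{u}) : Formula.{u} := imp φ bot

/-- Verum `⊤ := ¬ ⊥`. -/
def top : Formula.{u} := neg bot

/-- The dual modality `⟨α⟩ φ := ¬ [α] ¬ φ`. -/
def dia (α : Ordinal.{u}) (φ : Formula.{u}) : Formula.{u} := neg (box α (neg φ))

/-- `φ` is (a substitution instance of) a classical propositional tautology: it holds under every
truth assignment that respects `⊥` and `→`, where variables and boxed formulas get arbitrary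
truth values. -/
def IsTautology (φ : Formula.{u}) : Prop :=
  ∀ v : Formula.{u} → Prop,
    ¬ v bot → (∀ ψ χ : Formula.{u}, v (imp ψ χ) ↔ (v ψ → v χ)) → v φ

end Formula

open Formula in
/-- Derivability in the provability logic `GLP`, with a modality for every ordinal. -/
inductive Provable : Formula.{u} → Prop
  | taut (φ : Formula.{u}) : IsTautology φ → Provable φ
  | distrib (α : Ordinal.{u}) (χ ψ : Formula.{u}) :
      Provable (imp (box α (imp χ ψ)) (imp (box α χ) (box α ψ)))
  | loeb (α : Ordinal.{u}) (χ : Formula.{u}) :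
      Provable (imp (box α (imp (box α χ) χ)) (box α χ))
  | negIntro (α β : Ordinal.{u}) (ψ : Formula.{u}) : α < β →
      Provable (imp (dia α ψ) (box β (dia α ψ)))
  | mono (α β : Ordinal.{u}) (ψ : Formula.{u}) : α ≤ β →
      Provable (imp (box α ψ) (box β ψ))
  | mp (φ ψ : Formula.{u}) : Provable (imp φ ψ) → Provable φ → Provable ψ
  | nec (α : Ordinal.{u}) (ψ : Formula.{u}) : Provable ψ → Provable (box α ψ)

/-- Worms, identified with finite strings of ordinals: the string `α₁ … αₙ` stands for the
formula `⟨α₁⟩ … ⟨αₙ⟩ ⊤`. -/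
abbrev Worm : Type (u + 1) := List Ordinal.{u}

/-- The formula `⟨α₁⟩ … ⟨αₙ⟩ ⊤` denoted by a worm. -/
def Worm.toFormula : Worm.{u} → Formula.{u}
  | [] => Formula.top
  | α :: A => Formula.dia α (Worm.toFormula A)

/-- The relation `A <_ξ B`, i.e. `GLP ⊢ B → ⟨ξ⟩ A`, on all worms. -/
def wormLT (ξ : Ordinal.{u}) (A B : Worm.{u}) : Prop :=
  Provable (Formula.imp B.toFormula (Formula.dia ξ A.toFormula))

open Classical in
/-- `Ω_ξ(A) = sup {Ω_ξ(B) + 1 | B <_ξ A}`, by recursion on `<_ξ`. The default value `0` would be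
taken only if `<_ξ` were not well-founded. -/
noncomputable def Omega (ξ : Ordinal.{u}) (A : Worm.{u}) : Ordinal.{u} :=
  if h : WellFounded (wormLT.{u} ξ) then
    h.fix (C := fun _ => Ordinal.{u}) (fun A Ω =>
      sSup {o : Ordinal.{u} | ∃ (B : Worm.{u}) (hB : wormLT ξ B A), o = Ω B hB + 1}) A
  else 0

/-- The recursion equation for `Ω_ξ`. -/
theorem Omega_eq {ξ : Ordinal.{u}} (h : WellFounded (wormLT.{u} ξ)) (A : Worm.{u}) :
    Omega ξ A = sSup {o : Ordinal.{u} | ∃ B : Worm.{u}, wormLT ξ B A ∧ o = Omega ξ B + 1} := by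
  simp only [Omega, dif_pos h]
  rw [h.fix_eq]
  simp only [exists_prop]

theorem exists_endLog (η : Ordinal.{u}) (hη : η ≠ 0) :
    ∃ β α : Ordinal.{u}, η = α + ω ^ β := by
  induction η using WellFoundedLT.induction with
  | ind η ih =>
    have hdm := Ordinal.div_add_mod η (ω ^ log ω η)
    by_cases hr : η % ω ^ log ω η = 0
    · obtain ⟨n, hn⟩ := Ordinal.lt_omega0.1 (div_opow_log_lt η one_lt_omega0)
      rw [hr, add_zero, hn] at hdm
      cases n with
      | zero => exact absurd (by simpa using hdm.symm) hη
      | succ m =>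
        refine ⟨log ω η, ω ^ log ω η * (m : Ordinal), ?_⟩
        rw [Nat.cast_succ, mul_add_one] at hdm
        exact hdm.symm
    · obtain ⟨β, α, h⟩ := ih _ (mod_opow_log_lt_self ω hη) hr
      refine ⟨β, ω ^ log ω η * (η / ω ^ log ω η) + α, ?_⟩
      rw [add_assoc, ← h, hdm]

theorem endLog_le {α α' β β' : Ordinal.{u}} (h : α + ω ^ β = α' + ω ^ β') : β' ≤ β := by
  by_contra! hlt
  have hp : (ω : Ordinal.{u}) ^ β < ω ^ β' := (opow_lt_opow_iff_right one_lt_omega0).2 hlt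
  rcases le_total α α' with hle | hle
  · have h1 : α + ω ^ β < α' + ω ^ β' := calc
      α + ω ^ β < α + ω ^ β' := (add_lt_add_iff_left α).2 hp
      _ ≤ α' + ω ^ β' := by gcongr
    exact h1.ne h
  · obtain ⟨δ, rfl⟩ := exists_add_of_le hle
    rw [add_assoc, add_left_cancel_iff] at h
    rcases lt_or_ge δ (ω ^ β') with hδ | hδ
    · exact (isPrincipal_add_omega0_opow β' hδ hp).ne h
    · have h0 : (0 : Ordinal.{u}) < ω ^ β := opow_pos _ omega0_pos
      have : δ < δ + ω ^ β := lt_add_of_pos_right δ h0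
      exact (hδ.trans_lt this).ne h.symm

/-- For `η ≠ 0` there is a unique `β` such that `η = α + ω ^ β` for some `α`. -/
theorem existsUnique_endLog (η : Ordinal.{u}) (hη : η ≠ 0) :
    ∃! β : Ordinal.{u}, ∃ α : Ordinal.{u}, η = α + ω ^ β := by
  obtain ⟨β, α, h⟩ := exists_endLog η hη
  refine ⟨β, ⟨α, h⟩, ?_⟩
  rintro β' ⟨α', h'⟩
  exact le_antisymm (endLog_le (h.symm.trans h')) (endLog_le (h'.symm.trans h))

open Classical in
/-- `ℓ η` is the exponent of the last term of the Cantor normal form of `η`, that is, the unique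
`β` such that `η = α + ω ^ β` for some `α`, when `η ≠ 0`; and `ℓ 0 = 0`. -/
noncomputable def endLog (η : Ordinal.{u}) : Ordinal.{u} :=
  if h : η ≠ 0 then (existsUnique_endLog η h).choose else 0

end GLP

/-! ### Semantics: end logarithms and the Icard filters. -/

namespace GLP

open Ordinal Filter Set
open scoped Topology

/-! Everything rests on the formula `Omega_append_cons`: Ω_ξ(A ξ C) = Ω_ξ(C) + ω^{Ω_{ξ+1}(A)} when
the letters of A exceed ξ and those of C are at least ξ. The last exponent on the right is
Ω_{ξ+1}(A), and this is also Ω_{ξ+1}(A ξ C), because Ω_{ξ+1} does not see a tail that starts with a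
letter below ξ+1 (`Omega_append`).

The formula and well-foundedness both come from the structure of <_ξ. On worms with letters at least
ξ it is linear up to equivalence (`wormLT_trichotomy`), and a worm lying between C and A ξ C is
equivalent to B ξ C or equal to B ξ D, with B <_{ξ+1} A (`exists_of_lt_append`). Nested inductions
on <_{ξ+1} and on length then apply.

The one non-syntactic ingredient is irreflexivity of <_ξ. By Löb's axiom it reduces to the
irrefutability of worms, and then to that of ⟨α⟩⊤. This follows from soundness for a topological
model on the ordinals, in which a box means truth throughout a punctured left neighbourhood. A
single proof uses finitely many instances of the axioms, so finitely many ordinals need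
distinguishing and ℕ-many filters suffice (`Provable.sound`). -/

theorem endLog_add_opow (α β : Ordinal.{u}) : endLog (α + ω ^ β) = β := by
  have h : α + ω ^ β ≠ 0 := by
    have : (0 : Ordinal.{u}) < ω ^ β := opow_pos _ omega0_pos
    exact (this.trans_le le_add_self).ne'
  rw [endLog, dif_pos h]
  exact (existsUnique_endLog _ h).unique (existsUnique_endLog _ h).choose_spec.1 ⟨α, rfl⟩

theorem endLog_zero : endLog (0 : Ordinal.{u}) = 0 := by
  simp [endLog]

/-- For x = α + ω^β the point max(α, a) + ω^γ works: it stays below x because ω^β is additively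
principal. -/
theorem exists_endLog_eq {a x γ : Ordinal.{u}} (ha : a < x) (hγ : γ < endLog x) :
    ∃ y, a < y ∧ y < x ∧ endLog y = γ := by
  obtain ⟨β, α, rfl⟩ := exists_endLog x (pos_of_gt ha).ne'
  rw [endLog_add_opow] at hγ
  have hpos : (0 : Ordinal.{u}) < ω ^ γ := opow_pos _ omega0_pos
  have hlt : (ω : Ordinal.{u}) ^ γ < ω ^ β := (opow_lt_opow_iff_right one_lt_omega0).2 hγ
  refine ⟨max α a + ω ^ γ, ?_, ?_, endLog_add_opow _ _⟩
  · exact (le_max_right _ _).trans_lt (lt_add_of_pos_right _ hpos)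
  · rcases le_total a α with h | h
    · rw [max_eq_left h]
      exact (add_lt_add_iff_left α).2 hlt
    · obtain ⟨δ, rfl⟩ := exists_add_of_le h
      rw [max_eq_right h, add_assoc, add_lt_add_iff_left]
      exact isPrincipal_add_omega0_opow β ((add_lt_add_iff_left α).1 ha) hlt

/-- The filters of punctured neighbourhoods of the Icard topologies on the ordinals. -/
noncomputable def nbhd : ℕ → Ordinal.{u} → Filter Ordinal.{u}
  | 0, x => 𝓟 (Iio x)
  | n + 1, x => 𝓝[<] x ⊓ comap endLog (nbhd n (endLog x))

theorem Iio_mem_nbhd (n : ℕ) (x : Ordinal.{u}) : Iio x ∈ nbhd n x := by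
  cases n with
  | zero => exact mem_principal_self _
  | succ n => exact mem_inf_of_left self_mem_nhdsWithin

theorem nbhd_succ_le (n : ℕ) (x : Ordinal.{u}) : nbhd (n + 1) x ≤ nbhd n x := by
  induction n generalizing x with
  | zero => exact le_principal_iff.2 (Iio_mem_nbhd 1 x)
  | succ n ih => exact inf_le_inf_left _ (comap_mono (ih _))

theorem nbhd_antitone (x : Ordinal.{u}) : Antitone (fun n => nbhd n x) :=
  antitone_nat_of_succ_le fun n => nbhd_succ_le n x

theorem Ioo_mem_nbhd_succ (n : ℕ) {a x : Ordinal.{u}} (h : a < x) : Ioo a x ∈ nbhd (n + 1) x :=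
  mem_inf_of_left (Ioo_mem_nhdsLT h)

/-- Arbitrarily close to x on the left, `endLog` takes every value below `endLog x`, so intersecting
with 𝓝[<] x loses nothing in the image. Statements at level n + 1 thereby reduce to level n. -/
theorem map_endLog_nbhd_succ (n : ℕ) {x : Ordinal.{u}} (hx : x ≠ 0) :
    map endLog (nbhd (n + 1) x) = nbhd n (endLog x) := by
  refine le_antisymm ((map_mono inf_le_right).trans map_comap_le) ?_
  intro s hs
  obtain ⟨t, ht, w, hw, hst⟩ := mem_inf_iff_superset.1 (mem_map.1 hs)
  obtain ⟨U, hU, hUw⟩ := mem_comap.1 hw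
  obtain ⟨a, ha, hat⟩ := (mem_nhdsLT_iff_exists_Ioo_subset' (pos_iff_ne_zero.2 hx)).1 ht
  filter_upwards [hU, Iio_mem_nbhd n (endLog x)] with γ hγU hγ
  obtain ⟨y, hay, hyx, rfl⟩ := exists_endLog_eq ha hγ
  exact hst ⟨hat ⟨hay, hyx⟩, hUw hγU⟩

theorem eventually_nbhd_nbhd (n : ℕ) (x : Ordinal.{u}) {P : Ordinal.{u} → Prop}
    (h : ∀ᶠ y in nbhd n x, P y) : ∀ᶠ y in nbhd n x, ∀ᶠ z in nbhd n y, P z := by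
  induction n generalizing x P with
  | zero =>
    rw [nbhd, eventually_principal] at h ⊢
    intro y hy
    rw [nbhd, eventually_principal]
    exact fun z hz => h z (mem_Iio.2 (lt_trans (mem_Iio.1 hz) (mem_Iio.1 hy)))
  | succ n ih =>
    rcases eq_or_ne x 0 with rfl | hx
    · filter_upwards [Iio_mem_nbhd (n + 1) 0] with y hy
      exact absurd (mem_Iio.1 hy) not_lt_zero
    obtain ⟨t, ht, w, hw, hst⟩ := mem_inf_iff_superset.1 h
    obtain ⟨U, hU, hUw⟩ := mem_comap.1 hw
    obtain ⟨a, ha, hat⟩ := (mem_nhdsLT_iff_exists_Ioo_subset' (pos_iff_ne_zero.2 hx)).1 ht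
    have h2 : ∀ᶠ y in nbhd (n + 1) x, ∀ᶠ z in nbhd n (endLog y), z ∈ U :=
      mem_inf_of_right (preimage_mem_comap (ih (endLog x) hU))
    filter_upwards [h2, Ioo_mem_nbhd_succ n ha] with y hy hay
    have h3 : ∀ᶠ z in nbhd (n + 1) y, endLog z ∈ U :=
      mem_inf_of_right (preimage_mem_comap hy)
    filter_upwards [h3, Ioo_mem_nbhd_succ n hay.1] with z hzU hz
    exact hst ⟨hat ⟨hz.1, hz.2.trans hay.2⟩, hUw hzU⟩

/-- Transfinite induction on x: by transitivity of the filters the hypothesis at x passes to nearby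
y < x. -/
theorem eventually_nbhd_loeb (n : ℕ) (x : Ordinal.{u}) {P : Ordinal.{u} → Prop}
    (h : ∀ᶠ y in nbhd n x, (∀ᶠ z in nbhd n y, P z) → P y) : ∀ᶠ y in nbhd n x, P y := by
  induction x using WellFoundedLT.induction with
  | ind x ih =>
    filter_upwards [h, eventually_nbhd_nbhd n x h, Iio_mem_nbhd n x] with y h1 h2 h3
    exact h1 (ih y h3 h2)

theorem nbhd_neBot (n : ℕ) : ∃ x : Ordinal.{u}, (nbhd n x).NeBot := by
  induction n with
  | zero => exact ⟨1, principal_neBot_iff.2 ⟨0, mem_Iio.2 one_pos⟩⟩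
  | succ n ih =>
    obtain ⟨x, hx⟩ := ih
    refine ⟨0 + ω ^ x, ?_⟩
    rw [← map_neBot_iff endLog, map_endLog_nbhd_succ, endLog_add_opow]
    · exact hx
    · rw [zero_add]
      exact (opow_pos _ omega0_pos).ne'

/-! ### Sets for which the axiom ⟨α⟩ψ → [β]⟨α⟩ψ is valid. -/

/-- `A` is, to the left of every point, the preimage under `endLog` of a set with the same property,
`k` times iterated. -/
def LocallyLog : ℕ → (Ordinal.{u} → Prop) → Prop
  | 0, _ => True
  | k + 1, A => ∀ x ≠ 0, ∃ B, LocallyLog k B ∧ ∃ a < x, ∀ y, a < y → y ≤ x → (A y ↔ B (endLog y))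

theorem LocallyLog.const (k : ℕ) (p : Prop) : LocallyLog k (fun _ : Ordinal.{u} => p) := by
  induction k with
  | zero => trivial
  | succ k ih => exact fun x hx => ⟨_, ih, 0, pos_iff_ne_zero.2 hx, fun _ _ _ => Iff.rfl⟩

theorem LocallyLog.imp {k : ℕ} {A B : Ordinal.{u} → Prop} (hA : LocallyLog k A)
    (hB : LocallyLog k B) : LocallyLog k (fun x => A x → B x) := by
  induction k generalizing A B with
  | zero => trivial
  | succ k ih =>
    intro x hx
    obtain ⟨A', hA', a, ha, h1⟩ := hA x hx
    obtain ⟨B', hB', b, hb, h2⟩ := hB x hx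
    refine ⟨_, ih hA' hB', max a b, max_lt ha hb, fun y hy hyx => ?_⟩
    exact imp_congr (h1 y ((le_max_left _ _).trans_lt hy) hyx)
      (h2 y ((le_max_right _ _).trans_lt hy) hyx)

theorem eventually_nbhd_succ_iff (n : ℕ) {a x : Ordinal.{u}} {A B : Ordinal.{u} → Prop}
    (ha : a < x) (h : ∀ y, a < y → y < x → (A y ↔ B (endLog y))) :
    (∀ᶠ y in nbhd (n + 1) x, A y) ↔ ∀ᶠ v in nbhd n (endLog x), B v := by
  rw [← map_endLog_nbhd_succ n (pos_of_gt ha).ne', eventually_map]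
  refine eventually_congr ?_
  filter_upwards [Ioo_mem_nbhd_succ n ha] with y hy
  exact h y hy.1 hy.2

/-- A box of level n + 1 is locally the pullback of a box of level n. A box of level 0 is constant
just left of x: once some z < x violates `A`, the box fails at every later point. -/
theorem LocallyLog.eventually {k : ℕ} (n : ℕ) {A : Ordinal.{u} → Prop} (hA : LocallyLog k A) :
    LocallyLog k (fun x => ∀ᶠ y in nbhd n x, A y) := by
  induction k generalizing n A with
  | zero => trivial
  | succ k ih =>
    intro x hx
    cases n with
    | zero =>
      simp only [nbhd, eventually_principal]
      by_cases h : ∀ y ∈ Iio x, A y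
      · exact ⟨_, .const k True, 0, pos_iff_ne_zero.2 hx,
          fun y _ hyx => iff_true_intro fun z hz => h z (lt_of_lt_of_le hz hyx)⟩
      · push Not at h
        obtain ⟨z, hz, hAz⟩ := h
        exact ⟨_, .const k False, z, hz, fun y hy _ => iff_false_intro fun h => hAz (h z hy)⟩
    | succ n =>
      obtain ⟨B, hB, a, ha, h⟩ := hA x hx
      exact ⟨_, ih n hB, a, ha, fun y hy hyx => eventually_nbhd_succ_iff n hy
        fun z hz hzy => h z hz (hzy.le.trans hyx)⟩

/-- False for arbitrary sets. For locally pulled-back ones, `endLog` lowers the level until n = 0,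
where one counterexample z < x serves all y in (z, x). -/
theorem eventually_not_eventually_succ (n : ℕ) (x : Ordinal.{u}) {A : Ordinal.{u} → Prop}
    (hA : LocallyLog n A) (h : ¬ ∀ᶠ y in nbhd n x, A y) :
    ∀ᶠ y in nbhd (n + 1) x, ¬ ∀ᶠ z in nbhd n y, A z := by
  induction n generalizing x A with
  | zero =>
    simp only [nbhd, eventually_principal] at h
    push Not at h
    obtain ⟨z, hz, hAz⟩ := h
    filter_upwards [Ioo_mem_nbhd_succ 0 hz] with y hy
    rw [nbhd, eventually_principal]
    exact fun h => hAz (h z hy.1)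
  | succ n ih =>
    rcases eq_or_ne x 0 with rfl | hx
    · filter_upwards [Iio_mem_nbhd (n + 2) 0] with y hy
      exact absurd (mem_Iio.1 hy) not_lt_zero
    obtain ⟨B, hB, a, ha, hAB⟩ := hA x hx
    rw [eventually_nbhd_succ_iff n ha fun y hy hyx => hAB y hy hyx.le] at h
    have h2 := ih (endLog x) hB h
    refine (eventually_nbhd_succ_iff (n + 1) ha fun y hy hyx => ?_).2 h2
    rw [eventually_nbhd_succ_iff n hy fun z hz hzy => hAB z hz (hzy.trans hyx).le]

theorem eventually_not_eventually {n m : ℕ} (hnm : n < m) (x : Ordinal.{u})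
    {A : Ordinal.{u} → Prop} (hA : LocallyLog n A) (h : ¬ ∀ᶠ y in nbhd n x, A y) :
    ∀ᶠ y in nbhd m x, ¬ ∀ᶠ z in nbhd n y, A z :=
  nbhd_antitone x hnm (eventually_not_eventually_succ n x hA h)

/-! ### Soundness and irrefutability of ⟨α⟩⊤. -/

/-- Truth of a formula at an ordinal, where variables are false and the modality `α` is interpreted
by the `i α`-th topology. -/
def Sat (i : Ordinal.{u} → ℕ) : Formula.{u} → Ordinal.{u} → Prop
  | .var _, _ => False
  | .bot, _ => False
  | .imp φ ψ, x => Sat i φ x → Sat i ψ x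
  | .box α φ, x => ∀ᶠ y in nbhd (i α) x, Sat i φ y

theorem locallyLog_sat (i : Ordinal.{u} → ℕ) (k : ℕ) (φ : Formula.{u}) :
    LocallyLog k (Sat i φ) := by
  induction φ with
  | var _ => exact .const k False
  | bot => exact .const k False
  | imp φ ψ h1 h2 => exact h1.imp h2
  | box α φ h => exact h.eventually (i α)

/-- The number of elements of `S` below `α`. -/
noncomputable def index (S : Finset Ordinal.{u}) (α : Ordinal.{u}) : ℕ := (S.filter (· < α)).card

theorem index_mono (S : Finset Ordinal.{u}) : Monotone (index S) := fun α β h =>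
  Finset.card_le_card fun s hs => by
    rw [Finset.mem_filter] at hs ⊢
    exact ⟨hs.1, hs.2.trans_le h⟩

theorem index_lt {S : Finset Ordinal.{u}} {α β : Ordinal.{u}} (hα : α ∈ S) (h : α < β) :
    index S α < index S β := by
  refine Finset.card_lt_card (Finset.ssubset_iff_of_subset ?_ |>.2 ⟨α, ?_, ?_⟩)
  · intro s hs
    rw [Finset.mem_filter] at hs ⊢
    exact ⟨hs.1, hs.2.trans h⟩
  · exact Finset.mem_filter.2 ⟨hα, h⟩
  · simp

/-- `S` collects the smaller indices α from the instances of `negIntro`; having α in `T` makes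
`index T` strictly increase from α to β. Quantifying over all `T ⊇ S` lets modus ponens merge two
such sets. -/
theorem Provable.sound {φ : Formula.{u}} (h : Provable φ) :
    ∃ S : Finset Ordinal.{u}, ∀ T, S ⊆ T → ∀ x, Sat (index T) φ x := by
  induction h with
  | taut φ h =>
    exact ⟨∅, fun T _ x => h (fun ψ => Sat (index T) ψ x) id fun _ _ => Iff.rfl⟩
  | distrib α χ ψ =>
    exact ⟨∅, fun T _ x (h1 : ∀ᶠ _ in _, _) (h2 : ∀ᶠ _ in _, _) => h1.mp (h2.mono fun _ a b => b a)⟩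
  | loeb α χ => exact ⟨∅, fun T _ x h => eventually_nbhd_loeb _ x h⟩
  | negIntro α β ψ h =>
    refine ⟨{α}, fun T hT x hx => ?_⟩
    exact eventually_not_eventually (index_lt (Finset.singleton_subset_iff.1 hT) h) x
      (locallyLog_sat (index T) _ ψ.neg) hx
  | mono α β ψ h =>
    exact ⟨∅, fun T _ x hx => nbhd_antitone x (index_mono T h) hx⟩
  | mp φ ψ _ _ h1 h2 =>
    classical
    obtain ⟨S, hS⟩ := h1
    obtain ⟨S', hS'⟩ := h2
    exact ⟨S ∪ S', fun T hT x => hS T (Finset.union_subset_left hT) x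
      (hS' T (Finset.union_subset_right hT) x)⟩
  | nec α ψ _ h =>
    obtain ⟨S, hS⟩ := h
    exact ⟨S, fun T hT x => Eventually.of_forall (hS T hT)⟩

theorem not_provable_neg_dia_top (α : Ordinal.{u}) :
    ¬ Provable (Formula.neg (Formula.dia α Formula.top)) := by
  intro h
  obtain ⟨S, hS⟩ := h.sound
  obtain ⟨x, hx⟩ := nbhd_neBot.{u} (index S α)
  refine hS S subset_rfl x fun h' => ?_
  have h2 : ∀ᶠ y in nbhd (index S α) x, False := h'.mono fun y hy => hy id
  exact hx.ne (eventually_false_iff_eq_bot.1 h2)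

end GLP
-- Derivations in GLP and irreflexivity.
namespace GLP

open Formula

/-- Conjunction `φ ∧ ψ := ¬ (φ → ¬ ψ)`. -/
def Formula.and (φ ψ : Formula.{u}) : Formula.{u} := neg (imp φ (neg ψ))

/-- `GLP ⊢ φ → ψ`. -/
def Entails (φ ψ : Formula.{u}) : Prop := Provable (imp φ ψ)

namespace Entails

variable {φ ψ χ θ : Formula.{u}} {α β : Ordinal.{u}}

theorem refl (φ : Formula.{u}) : Entails φ φ :=
  .taut _ fun v _ h => by simp [h]

theorem trans (h1 : Entails φ ψ) (h2 : Entails ψ χ) : Entails φ χ :=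
  .mp _ _ (.mp _ _ (.taut (imp (imp φ ψ) (imp (imp ψ χ) (imp φ χ))) fun v _ h => by
    simp only [h]; tauto) h1) h2

theorem and_intro (h1 : Entails φ ψ) (h2 : Entails φ χ) : Entails φ (ψ.and χ) :=
  .mp _ _ (.mp _ _ (.taut (imp (imp φ ψ) (imp (imp φ χ) (imp φ (ψ.and χ)))) fun v h0 h => by
    simp only [h, Formula.and, neg, h0]; tauto) h1) h2

theorem and_left (φ ψ : Formula.{u}) : Entails (φ.and ψ) φ :=
  .taut _ fun v h0 h => by simp only [h, Formula.and, neg, h0]; tauto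

theorem and_right (φ ψ : Formula.{u}) : Entails (φ.and ψ) ψ :=
  .taut _ fun v h0 h => by simp only [h, Formula.and, neg, h0]; tauto

theorem to_top (φ : Formula.{u}) : Entails φ top :=
  .taut _ fun v h0 h => by simp only [h, top, neg, h0]; tauto

theorem curry (h : Entails (φ.and ψ) χ) : Entails φ (imp ψ χ) :=
  .mp _ _ (.taut (imp (imp (φ.and ψ) χ) (imp φ (imp ψ χ))) fun v h0 h => by
    simp only [h, Formula.and, neg, h0]; tauto) h

theorem neg_anti (h : Entails φ ψ) : Entails ψ.neg φ.neg :=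
  .mp _ _ (.taut (imp (imp φ ψ) (imp ψ.neg φ.neg)) fun v h0 h => by
    simp only [h, neg, h0]; tauto) h

theorem box_mono (h : Entails φ ψ) : Entails (box α φ) (box α ψ) :=
  .mp _ _ (.distrib α φ ψ) (.nec α _ h)

theorem dia_mono (h : Entails φ ψ) : Entails (dia α φ) (dia α ψ) :=
  h.neg_anti.box_mono.neg_anti

/-- Löb's axiom is applied to φ ∧ [α]φ. -/
theorem box_four (α : Ordinal.{u}) (φ : Formula.{u}) : Entails (box α φ) (box α (box α φ)) := by
  have h1 : Entails φ (imp (box α (φ.and (box α φ))) (φ.and (box α φ))) :=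
    curry (and_intro (and_left _ _) ((and_right _ _).trans (box_mono (and_left _ _))))
  exact trans (box_mono h1) (trans (.loeb α _) (box_mono (and_right _ _)))

theorem dia_dia_of_box {φ : Formula.{u}} (α : Ordinal.{u}) :
    Entails (dia α (dia α φ)) (dia α φ) := by
  have h : Entails (box α φ.neg) (box α (dia α φ).neg) :=
    (box_four α _).trans (box_mono (.taut _ fun v h0 h => by
      simp only [h, dia, neg, h0]; tauto))
  exact h.neg_anti

theorem dia_le (h : α ≤ β) (φ : Formula.{u}) : Entails (dia β φ) (dia α φ) :=
  neg_anti (.mono α β _ h)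

theorem dia_dia (hα : α ≤ β) (φ : Formula.{u}) : Entails (dia β (dia α φ)) (dia α φ) :=
  (dia_le hα _).trans (dia_dia_of_box α)

theorem dia_and_box (α : Ordinal.{u}) (φ ψ : Formula.{u}) :
    Entails ((dia α φ).and (box α ψ)) (dia α (φ.and ψ)) := by
  have h : Entails (box α ψ) (imp (box α (φ.and ψ).neg) (box α φ.neg)) :=
    (box_mono (.taut (imp ψ (imp (φ.and ψ).neg φ.neg)) fun v h0 h => by
      simp only [h, Formula.and, neg, h0]; tauto)).trans (.distrib α _ _)
  exact .mp _ _ (.taut (imp (imp (box α ψ) (imp (box α (φ.and ψ).neg) (box α φ.neg)))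
    (imp ((dia α φ).and (box α ψ)) (dia α (φ.and ψ)))) fun v h0 h => by
      simp only [h, dia, Formula.and, neg, h0]; tauto) h

theorem dia_and_dia (h : α < β) (φ ψ : Formula.{u}) :
    Entails ((dia β φ).and (dia α ψ)) (dia β (φ.and (dia α ψ))) :=
  (and_intro (and_left _ _) ((and_right _ _).trans (.negIntro α β ψ h))).trans (dia_and_box β _ _)

end Entails

/-- From ⟨β⟩A one gets ⟨a⟩A, and a diamond of index a < β may be moved inside ⟨β⟩. -/
theorem dia_top_entails_dia (A : Worm.{u}) {β : Ordinal.{u}} (h : ∀ a ∈ A, a < β) :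
    Entails (dia β top) (dia β A.toFormula) := by
  induction A with
  | nil => exact .refl _
  | cons a A ih =>
    have h1 := ih fun b hb => h b (List.mem_cons_of_mem _ hb)
    have ha : a < β := h a List.mem_cons_self
    exact (Entails.and_intro (.refl _) (h1.trans (.dia_le ha.le _))).trans
      ((Entails.dia_and_dia ha _ _).trans (.dia_mono (.and_right _ _)))

theorem exists_forall_mem_lt (A : Worm.{u}) : ∃ β : Ordinal.{u}, ∀ a ∈ A, a < β := by
  induction A with
  | nil => exact ⟨0, by simp⟩
  | cons a A ih =>
    obtain ⟨β, hβ⟩ := ih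
    refine ⟨max (a + 1) β, fun b hb => ?_⟩
    rcases List.mem_cons.1 hb with rfl | hb
    · exact lt_max_of_lt_left (lt_add_one b)
    · exact lt_max_of_lt_right (hβ b hb)

/-- No worm is refutable, hence `<_ξ` is irreflexive. -/
theorem not_provable_neg_worm (A : Worm.{u}) : ¬ Provable A.toFormula.neg := by
  intro h
  obtain ⟨β, hβ⟩ := exists_forall_mem_lt A
  apply not_provable_neg_dia_top β
  have h1 : Provable (dia β A.toFormula).neg :=
    .mp _ _ (.taut (imp (box β A.toFormula.neg) (dia β A.toFormula).neg) fun v h0 h => by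
      simp only [h, dia, neg, h0]; tauto) (.nec β _ h)
  exact .mp _ _ (Entails.neg_anti (dia_top_entails_dia A hβ)) h1

/-- If A → ⟨ξ⟩A were provable, then so would be [ξ]¬A → ¬A, and Löb's axiom would refute A. -/
theorem wormLT_irrefl (ξ : Ordinal.{u}) (A : Worm.{u}) : ¬ wormLT ξ A A := by
  intro h
  have h1 : Entails (box ξ A.toFormula.neg) A.toFormula.neg :=
    .mp _ _ (.taut (imp (imp A.toFormula (dia ξ A.toFormula))
      (imp (box ξ A.toFormula.neg) A.toFormula.neg)) fun v h0 h => by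
      simp only [h, dia, neg, h0]; tauto) h
  exact not_provable_neg_worm A (.mp _ _ h1 (.mp _ _ (.loeb ξ _) (.nec ξ _ h1)))

theorem wormLT.trans {ξ : Ordinal.{u}} {A B C : Worm.{u}} (h1 : wormLT ξ A B)
    (h2 : wormLT ξ B C) : wormLT ξ A C :=
  Entails.trans h2 ((Entails.dia_mono h1).trans (.dia_dia le_rfl _))

/-! ### Splitting worms into head and tail; linearity. -/

/-- `GLP ⊢ B → A` for worms. -/
def WormLE (A B : Worm.{u}) : Prop := Entails B.toFormula A.toFormula

theorem WormLE.refl (A : Worm.{u}) : WormLE A A := Entails.refl _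

theorem WormLE.trans {A B C : Worm.{u}} (h1 : WormLE A B) (h2 : WormLE B C) : WormLE A C :=
  Entails.trans h2 h1

theorem wormLT.trans_le {ξ : Ordinal.{u}} {A B C : Worm.{u}} (h1 : wormLT ξ A B)
    (h2 : WormLE B C) : wormLT ξ A C := Entails.trans h2 h1

theorem WormLE.trans_lt {ξ : Ordinal.{u}} {A B C : Worm.{u}} (h1 : WormLE A B)
    (h2 : wormLT ξ B C) : wormLT ξ A C := Entails.trans h2 (.dia_mono h1)

theorem wormLT.of_le {ξ ζ : Ordinal.{u}} {A B : Worm.{u}} (h : wormLT ζ A B) (hξ : ξ ≤ ζ) :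
    wormLT ξ A B := Entails.trans h (.dia_le hξ _)

theorem wormLT_cons (ξ : Ordinal.{u}) (A : Worm.{u}) : wormLT ξ A (ξ :: A) := Entails.refl _

/-- All letters of `A` are at least `ξ`. -/
def Above (ξ : Ordinal.{u}) (A : Worm.{u}) : Prop := ∀ a ∈ A, ξ ≤ a

/-- The first letter of `A`, if there is one, is less than `ξ`. -/
def StartsBelow (ξ : Ordinal.{u}) (A : Worm.{u}) : Prop := ∀ a ∈ A.head?, a < ξ

theorem Above.mono {ξ ζ : Ordinal.{u}} {A : Worm.{u}} (h : Above ζ A) (hξ : ξ ≤ ζ) : Above ξ A :=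
  fun a ha => hξ.trans (h a ha)

theorem above_nil (ξ : Ordinal.{u}) : Above ξ [] := by simp [Above]

theorem above_append {ξ : Ordinal.{u}} {A B : Worm.{u}} :
    Above ξ (A ++ B) ↔ Above ξ A ∧ Above ξ B := by
  simp [Above, or_imp, forall_and]

theorem above_cons {ξ a : Ordinal.{u}} {A : Worm.{u}} :
    Above ξ (a :: A) ↔ ξ ≤ a ∧ Above ξ A := by
  simp [Above]

theorem startsBelow_nil (ξ : Ordinal.{u}) : StartsBelow ξ [] := by simp [StartsBelow]

theorem startsBelow_cons {ξ a : Ordinal.{u}} {A : Worm.{u}} : StartsBelow ξ (a :: A) ↔ a < ξ := by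
  simp [StartsBelow]

theorem StartsBelow.mono {ξ ζ : Ordinal.{u}} {A : Worm.{u}} (h : StartsBelow ξ A) (hξ : ξ ≤ ζ) :
    StartsBelow ζ A :=
  fun a ha => (h a ha).trans_le hξ

theorem StartsBelow.append {ξ : Ordinal.{u}} {A B : Worm.{u}} (hA : StartsBelow ξ A)
    (hB : StartsBelow ξ B) : StartsBelow ξ (A ++ B) := by
  cases A with
  | nil => exact hB
  | cons a A => exact startsBelow_cons.2 (startsBelow_cons.1 hA)

theorem dia_and_worm {ξ : Ordinal.{u}} {r : Worm.{u}} (hr : StartsBelow ξ r) (φ : Formula.{u}) :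
    Entails ((dia ξ φ).and r.toFormula) (dia ξ (φ.and r.toFormula)) := by
  cases r with
  | nil =>
    exact (Entails.and_left _ _).trans (.dia_mono (.and_intro (.refl _) (.to_top _)))
  | cons a r => exact .dia_and_dia (startsBelow_cons.1 hr) _ _

theorem WormLE.append_left (h r : Worm.{u}) : WormLE h (h ++ r) := by
  induction h with
  | nil => exact .to_top _
  | cons a h ih => exact .dia_mono ih

theorem WormLE.append_right {ξ : Ordinal.{u}} {h r : Worm.{u}} (hh : Above ξ h)
    (hr : StartsBelow ξ r) : WormLE r (h ++ r) := by
  induction h with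
  | nil => exact .refl _
  | cons a h ih =>
    refine Entails.trans (.dia_mono (ih (above_cons.1 hh).2)) ?_
    cases r with
    | nil => exact .to_top _
    | cons b r => exact .dia_dia ((startsBelow_cons.1 hr).le.trans (above_cons.1 hh).1) _

/-- The first letter of r is smaller than every letter of h, so r moves inward through all of h. -/
theorem and_entails_append {ξ : Ordinal.{u}} {h r : Worm.{u}} (hh : Above ξ h)
    (hr : StartsBelow ξ r) :
    Entails (h.toFormula.and r.toFormula) (Worm.toFormula (h ++ r)) := by
  induction h with
  | nil => exact .and_right _ _
  | cons a h ih =>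
    have hra : StartsBelow a r := hr.mono (above_cons.1 hh).1
    exact (dia_and_worm hra _).trans (.dia_mono (ih (above_cons.1 hh).2))

theorem WormLE.append {ξ : Ordinal.{u}} {h r B : Worm.{u}} (hh : Above ξ h)
    (hr : StartsBelow ξ r) (h1 : WormLE h B) (h2 : WormLE r B) : WormLE (h ++ r) B :=
  (Entails.and_intro h1 h2).trans (and_entails_append hh hr)

theorem wormLT.append {ξ : Ordinal.{u}} {h r B : Worm.{u}} (hh : Above ξ h)
    (hr : StartsBelow ξ r) (h1 : wormLT ξ h B) (h2 : WormLE r B) : wormLT ξ (h ++ r) B :=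
  (Entails.and_intro h1 h2).trans ((dia_and_worm hr _).trans (.dia_mono (and_entails_append hh hr)))

theorem exists_append (ξ : Ordinal.{u}) (A : Worm.{u}) :
    ∃ h r, A = h ++ r ∧ Above ξ h ∧ StartsBelow ξ r := by
  induction A with
  | nil => exact ⟨[], [], rfl, above_nil ξ, startsBelow_nil ξ⟩
  | cons a A ih =>
    rcases lt_or_ge a ξ with ha | ha
    · exact ⟨[], a :: A, rfl, above_nil ξ, startsBelow_cons.2 ha⟩
    · obtain ⟨h, r, rfl, hh, hr⟩ := ih
      exact ⟨a :: h, r, rfl, above_cons.2 ⟨ha, hh⟩, hr⟩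

/-- Decomposition of a worm with letters at least `ξ` at the first occurrence of `ξ`. -/
theorem Above.cases {ξ : Ordinal.{u}} {A : Worm.{u}} (hA : Above ξ A) :
    Above (ξ + 1) A ∨
      ∃ B C, A = B ++ ξ :: C ∧ Above (ξ + 1) B ∧ Above ξ C := by
  obtain ⟨h, r, rfl, hh, hr⟩ := exists_append (ξ + 1) A
  cases r with
  | nil => exact .inl (by simpa using hh)
  | cons a r =>
    have h1 := above_cons.1 (above_append.1 hA).2
    obtain rfl : a = ξ := le_antisymm (Order.lt_add_one_iff.1 (startsBelow_cons.1 hr)) h1.1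
    exact .inr ⟨h, r, rfl, hh, h1.2⟩

theorem exists_min_letter {A : Worm.{u}} (hA : A ≠ []) : ∃ m ∈ A, Above m A := by
  obtain ⟨m, hm, h⟩ := A.toFinset.exists_min_image id (by simpa [List.toFinset_nonempty_iff] using hA)
  exact ⟨m, by simpa using hm, fun a ha => h a (by simpa using ha)⟩

/-- Linearity of `<_ξ` on worms with letters at least `ξ`. -/
theorem wormLT_trichotomy {ξ : Ordinal.{u}} {A B : Worm.{u}} (hA : Above ξ A) (hB : Above ξ B) :
    wormLT ξ A B ∨ (WormLE A B ∧ WormLE B A) ∨ wormLT ξ B A := by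
  induction hn : A.length + B.length using Nat.strong_induction_on generalizing ξ A B with
  | _ n ih =>
    subst hn
    by_cases hne : A ++ B = []
    · obtain ⟨rfl, rfl⟩ := List.append_eq_nil_iff.1 hne
      exact .inr (.inl ⟨.refl _, .refl _⟩)
    obtain ⟨m, hm, hAB⟩ := exists_min_letter hne
    have hξ : ξ ≤ m := above_append.2 ⟨hA, hB⟩ m hm
    suffices H : wormLT m A B ∨ (WormLE A B ∧ WormLE B A) ∨ wormLT m B A from
      H.imp (·.of_le hξ) (.imp_right (·.of_le hξ))
    obtain ⟨hA, hB⟩ := above_append.1 hAB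
    -- For r = m C, compare C with B' by induction. C <_m B' is literally r ≤ B'; otherwise B' is
    -- equivalent to C or B' <_m C, and C <_m A' gives B' <_m A'.
    have tail : ∀ A' B' r : Worm.{u}, r.length ≤ A'.length → Above m B' → Above m r →
        A'.length + B'.length = A.length + B.length → StartsBelow (m + 1) r → WormLE r A' →
        wormLT m B' A' ∨ WormLE r B' := by
      intro A' B' r hl hB' hr hn h1 h2
      cases r with
      | nil => exact .inr (Entails.to_top _)
      | cons a C =>
        obtain ⟨ha, hC⟩ := above_cons.1 hr
        obtain rfl : a = m := le_antisymm (Order.lt_add_one_iff.1 (startsBelow_cons.1 h1)) ha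
        have h3 : C.length < A'.length := hl
        rcases ih _ (by omega : C.length + B'.length < _) hC hB' rfl with h | h | h
        · exact .inr h
        · exact .inl (h.2.trans_lt h2)
        · exact .inl (h.trans h2)
    obtain ⟨A₀, r, hAe, hA₀, hr⟩ := exists_append (m + 1) A
    obtain ⟨B₀, s, hBe, hB₀, hs⟩ := exists_append (m + 1) B
    -- The letter m occurs in A or B but in neither head.
    have hlen : A₀.length + B₀.length < A.length + B.length := by
      have hl1 := congrArg List.length hAe
      have hl2 := congrArg List.length hBe
      rw [List.length_append] at hl1 hl2
      by_contra! hle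
      obtain rfl : r = [] := List.length_eq_zero_iff.1 (by omega)
      obtain rfl : s = [] := List.length_eq_zero_iff.1 (by omega)
      rw [List.append_nil] at hAe hBe
      subst hAe hBe
      exact absurd (above_append.2 ⟨hA₀, hB₀⟩ m hm) (not_le.2 (lt_add_one m))
    have hlA : r.length ≤ A.length := by rw [hAe]; simp
    have hlB : s.length ≤ B.length := by rw [hBe]; simp
    have hrm : Above m r := (above_append.1 (hAe ▸ hA)).2
    have hsm : Above m s := (above_append.1 (hBe ▸ hB)).2
    have hA1 : WormLE A₀ A := hAe ▸ .append_left A₀ r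
    have hA2 : WormLE r A := hAe ▸ .append_right hA₀ hr
    have hB1 : WormLE B₀ B := hBe ▸ .append_left B₀ s
    have hB2 : WormLE s B := hBe ▸ .append_right hB₀ hs
    rcases tail A B r hlA hB hrm rfl hr hA2 with h | hrB
    · exact .inr (.inr h)
    rcases tail B A s hlB hA hsm (by omega) hs hB2 with h | hsA
    · exact .inl h
    -- Each tail now follows from the opposite worm, so the comparison of the heads at m + 1
    -- decides.
    rcases ih _ hlen hA₀ hB₀ rfl with h | h | h
    · exact .inl (hAe ▸ (wormLT.append hA₀ hr (h.trans_le hB1) hrB).of_le (lt_add_one m).le)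
    · refine .inr (.inl ⟨hAe ▸ .append hA₀ hr (h.1.trans hB1) hrB,
        hBe ▸ .append hB₀ hs (h.2.trans hA1) hsA⟩)
    · exact .inr (.inr (hBe ▸ (wormLT.append hB₀ hs (h.trans_le hA1) hsA).of_le (lt_add_one m).le))

end GLP
-- Well-foundedness.
namespace GLP

open Ordinal

/-- Linearity of <_ζ leaves two other cases, and each contradicts irreflexivity of <_ξ. -/
theorem wormLT.of_above {ξ ζ : Ordinal.{u}} {A B : Worm.{u}} (hA : Above ζ A) (hB : Above ζ B)
    (hξ : ξ ≤ ζ) (h : wormLT ξ B A) : wormLT ζ B A := by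
  rcases wormLT_trichotomy hB hA with h' | h' | h'
  · exact h'
  · exact absurd (h'.2.trans_lt h) (wormLT_irrefl ξ A)
  · exact absurd (h.trans (h'.of_le hξ)) (wormLT_irrefl ξ B)

theorem WormLE.of_not_lt {ξ : Ordinal.{u}} {A B : Worm.{u}} (hA : Above ξ A) (hB : Above ξ B)
    (h : ¬ wormLT ξ A B) : WormLE B A ∨ wormLT ξ B A := by
  rcases wormLT_trichotomy hA hB with h' | h' | h'
  · exact absurd h' h
  · exact .inl h'.2
  · exact .inr h'

/-- The restriction of `<_ξ` to predecessors with letters at least `ξ`. -/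
def AboveLT (ξ : Ordinal.{u}) (B A : Worm.{u}) : Prop := Above ξ B ∧ wormLT ξ B A

theorem acc_of_le {ξ : Ordinal.{u}} {A B : Worm.{u}} (hA : Acc (AboveLT ξ) A) (h : WormLE B A) :
    Acc (AboveLT ξ) B :=
  ⟨_, fun _ hC => hA.inv ⟨hC.1, hC.2.trans_le h⟩⟩

/-- A worm `B` between `C` and `A ξ C` is equivalent to `B ξ C` with `B <_{ξ+1} A`, or it is of the
form `B₀ ξ D` with `B₀ <_{ξ+1} A`. -/
theorem exists_of_lt_append {ξ : Ordinal.{u}} {A B C : Worm.{u}} (hA : Above (ξ + 1) A)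
    (hB : Above ξ B) (h1 : wormLT ξ C B) (h2 : wormLT ξ B (A ++ ξ :: C)) :
    (Above (ξ + 1) B ∧ wormLT (ξ + 1) B A ∧ WormLE B (B ++ ξ :: C) ∧ WormLE (B ++ ξ :: C) B) ∨
      ∃ B₀ D, B = B₀ ++ ξ :: D ∧ Above (ξ + 1) B₀ ∧ Above ξ D ∧ wormLT (ξ + 1) B₀ A := by
  have hs : ∀ D : Worm.{u}, StartsBelow (ξ + 1) (ξ :: D) := fun D =>
    startsBelow_cons.2 (lt_add_one ξ)
  -- Otherwise B would imply A or ⟨ξ+1⟩A; together with C <_ξ B it would then imply A ξ C or ⟨ξ⟩(A ξ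
  -- C), contradicting B <_ξ A ξ C.
  have key : ∀ B₀, Above (ξ + 1) B₀ → WormLE B₀ B → wormLT (ξ + 1) B₀ A := by
    intro B₀ hB₀ hle
    by_contra hlt
    rcases WormLE.of_not_lt hB₀ hA hlt with h | h
    · exact wormLT_irrefl ξ B (h2.trans_le (WormLE.append hA (hs C) (h.trans hle) h1))
    · exact wormLT_irrefl ξ B
        (h2.trans ((wormLT.append hA (hs C) (h.trans_le hle) h1).of_le (lt_add_one ξ).le))
  rcases hB.cases with hB' | ⟨B₀, D, rfl, hB₀, hD⟩
  · exact .inl ⟨hB', key B hB' (.refl B), .append_left _ _, .append hB' (hs C) (.refl B) h1⟩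
  · exact .inr ⟨B₀, D, rfl, hB₀, hD, key B₀ hB₀ (.append_left _ _)⟩

theorem wormLT_append_cons {ξ : Ordinal.{u}} {A : Worm.{u}} (hA : Above (ξ + 1) A) (C : Worm.{u}) :
    wormLT ξ C (A ++ ξ :: C) :=
  (wormLT_cons ξ C).trans_le (.append_right hA (startsBelow_cons.2 (lt_add_one ξ)))

/-- Induction on A along <_{ξ+1}, then on the length of the predecessor B. When B = B₀ ξ D, the
shorter worm D is again below A ξ C and the head B₀ is below A. -/
theorem acc_append {ξ : Ordinal.{u}} {A C : Worm.{u}} (hA : Above (ξ + 1) A) (hC : Above ξ C)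
    (hAacc : Acc (AboveLT (ξ + 1)) A) (hCacc : Acc (AboveLT ξ) C) :
    Acc (AboveLT ξ) (A ++ ξ :: C) := by
  induction hAacc generalizing C with
  | intro A _ ih =>
    have main : ∀ n (B : Worm.{u}), B.length = n → Above ξ B → wormLT ξ B (A ++ ξ :: C) →
        Acc (AboveLT ξ) B := by
      intro n
      induction n using Nat.strong_induction_on with
      | _ n ihn =>
        intro B hn hB hlt
        by_cases hCB : wormLT ξ C B
        · rcases exists_of_lt_append hA hB hCB hlt with
            ⟨hB', hBA, hle, -⟩ | ⟨B₀, D, rfl, hB₀, hD, hBA⟩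
          · exact acc_of_le (ih B ⟨hB', hBA⟩ hB' hC hCacc) hle
          · refine ih B₀ ⟨hB₀, hBA⟩ hB₀ hD (ihn _ ?_ D rfl hD ?_)
            · rw [← hn]; simp; omega
            · exact (wormLT_append_cons hB₀ D).trans hlt
        · rcases WormLE.of_not_lt hC hB hCB with h | h
          · exact acc_of_le hCacc h
          · exact hCacc.inv ⟨hB, h⟩
    exact ⟨_, fun B hB => main _ B rfl hB.1 hB.2⟩

/-- Lowering the index admits predecessors B with letters below ζ. Such a B is split at its least
letter m < ζ; its two shorter parts are still below A and are accessible at m + 1 ≤ ζ and at m, and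
the outer induction goes down from m to ξ. -/
theorem acc_of_acc_above {ξ ζ : Ordinal.{u}} {A : Worm.{u}} (hξ : ξ ≤ ζ) (hA : Above ζ A)
    (h : Acc (AboveLT ζ) A) : Acc (AboveLT ξ) A := by
  induction ζ using WellFoundedLT.induction generalizing ξ A with
  | ind ζ ihζ =>
    induction h generalizing ξ with
    | intro A _ ih =>
      have main : ∀ n ξ (B : Worm.{u}), ξ ≤ ζ → B.length = n → Above ξ B → wormLT ξ B A →
          Acc (AboveLT ξ) B := by
        intro n
        induction n using Nat.strong_induction_on with
        | _ n ihn =>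
          intro ξ B hξ hn hB hlt
          by_cases hBζ : Above ζ B
          · exact ih B ⟨hBζ, hlt.of_above hA hBζ hξ⟩ hξ hBζ
          have hne : B ≠ [] := by rintro rfl; exact hBζ (above_nil ζ)
          obtain ⟨m, hm, hBm⟩ := exists_min_letter hne
          have hmζ : m < ζ := lt_of_not_ge fun hle => hBζ (hBm.mono hle)
          refine ihζ m hmζ (hB m hm) hBm ?_
          have hlt : wormLT m B A := hlt.of_above (hA.mono hmζ.le) hBm (hB m hm)
          have hmζ' : m + 1 ≤ ζ := Order.add_one_le_iff.2 hmζ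
          rcases hBm.cases with hB' | ⟨B₀, D, rfl, hB₀, hD⟩
          · exact absurd (hB' m hm) (not_le.2 (lt_add_one m))
          · refine acc_append hB₀ hD (ihn _ ?_ (m + 1) B₀ hmζ' rfl hB₀ ?_)
              (ihn _ ?_ m D hmζ.le rfl hD ?_)
            · rw [← hn]; simp
            · exact wormLT.of_above (hA.mono hmζ') hB₀ (lt_add_one m).le
                ((WormLE.append_left _ _).trans_lt hlt)
            · rw [← hn]; simp; omega
            · exact (wormLT_append_cons hB₀ D).trans hlt
      exact ⟨_, fun B hB => main _ ξ B hξ rfl hB.1 hB.2⟩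

theorem acc_aboveLT {ξ : Ordinal.{u}} {A : Worm.{u}} (hA : Above ξ A) : Acc (AboveLT ξ) A := by
  induction hn : A.length using Nat.strong_induction_on generalizing ξ A with
  | _ n ih =>
    subst hn
    rcases eq_or_ne A [] with rfl | hne
    · exact ⟨_, fun B hB => absurd ((show WormLE [] B from .to_top _).trans_lt hB.2)
        (wormLT_irrefl ξ [])⟩
    obtain ⟨m, hm, hAm⟩ := exists_min_letter hne
    refine acc_of_acc_above (hA m hm) hAm ?_
    rcases hAm.cases with hA' | ⟨A₀, D, rfl, hA₀, hD⟩
    · exact absurd (hA' m hm) (not_le.2 (lt_add_one m))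
    · exact acc_append hA₀ hD (ih _ (by simp) hA₀ rfl) (ih _ (by simp; omega) hD rfl)

/-- Passage to the longest initial segments with letters at least `ξ` preserves `<_ξ`. -/
theorem wormLT.head {ξ : Ordinal.{u}} {A B r s : Worm.{u}} (hA : Above ξ A) (hB : Above ξ B)
    (hr : StartsBelow ξ r) (h : wormLT ξ (B ++ s) (A ++ r)) : wormLT ξ B A := by
  by_contra hlt
  have h1 : wormLT ξ B (A ++ r) := (WormLE.append_left B s).trans_lt h
  have h2 : wormLT ξ A (A ++ r) := by
    rcases WormLE.of_not_lt hB hA hlt with h' | h'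
    · exact h'.trans_lt h1
    · exact h'.trans h1
  exact wormLT_irrefl ξ _ (wormLT.append hA hr h2 (.append_right hA hr))

theorem acc_wormLT {ξ : Ordinal.{u}} {A : Worm.{u}} (hA : Above ξ A) (r : Worm.{u})
    (hr : StartsBelow ξ r) : Acc (wormLT ξ) (A ++ r) := by
  induction acc_aboveLT hA generalizing r with
  | intro A _ ih =>
    refine ⟨_, fun B hB => ?_⟩
    obtain ⟨B, s, rfl, hB', hs⟩ := exists_append ξ B
    exact ih B ⟨hB', hB.head hA hB' hr⟩ hB' s hs

theorem wormLT_wellFounded (ξ : Ordinal.{u}) : WellFounded (wormLT.{u} ξ) :=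
  ⟨fun A => by
    obtain ⟨A, r, rfl, hA, hr⟩ := exists_append ξ A
    exact acc_wormLT hA r hr⟩

/-! ### Computation of the order types. -/

theorem Omega_append {ξ : Ordinal.{u}} {A : Worm.{u}} (hA : Above ξ A) (r : Worm.{u})
    (hr : StartsBelow ξ r) : Omega ξ (A ++ r) = Omega ξ A := by
  induction acc_aboveLT hA generalizing r with
  | intro A _ ih =>
    rw [Omega_eq (wormLT_wellFounded ξ), Omega_eq (wormLT_wellFounded ξ)]
    congr 1
    ext o
    constructor
    · rintro ⟨B, hB, rfl⟩
      obtain ⟨B, s, rfl, hB', hs⟩ := exists_append ξ B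
      have h := hB.head hA hB' hr
      exact ⟨B, h, by rw [ih B ⟨hB', h⟩ hB' s hs]⟩
    · rintro ⟨B, hB, rfl⟩
      exact ⟨B, hB.trans_le (.append_left _ _), rfl⟩

theorem wormLT_of_mem {ξ b : Ordinal.{u}} {A B : Worm.{u}} (hB : Above ξ B) (hb : b ∈ B)
    (hA : ∀ a ∈ A, a < b) : wormLT ξ A B := by
  induction B with
  | nil => simp at hb
  | cons c B ih =>
    obtain ⟨hc, hB⟩ := above_cons.1 hB
    rcases List.mem_cons.1 hb with rfl | hb
    · exact wormLT.of_le (Entails.trans (.dia_mono (.to_top _)) (dia_top_entails_dia A hA)) hc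
    · exact Entails.trans (.dia_mono (ih hB hb)) (.dia_dia hc _)

/-- Worms live one universe up, so boundedness is not automatic. A predecessor may be replaced by
its head, whose letters are below any strict bound μ for the letters of A; words over `Iio μ` form a
small type. -/
theorem bddAbove_Omega (ξ : Ordinal.{u}) (A : Worm.{u}) :
    BddAbove {o : Ordinal.{u} | ∃ B : Worm.{u}, wormLT ξ B A ∧ o = Omega ξ B + 1} := by
  obtain ⟨μ, hμ⟩ := exists_forall_mem_lt A
  have hsmall : BddAbove (Set.range fun B : List (Set.Iio μ) =>
      Omega ξ (B.map Subtype.val) + 1) := bddAbove_of_small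
  refine hsmall.mono ?_
  rintro _ ⟨B, hB, rfl⟩
  obtain ⟨B, s, rfl, hB', hs⟩ := exists_append ξ B
  rw [Omega_append hB' s hs]
  have hlt : ∀ b ∈ B, b < μ := by
    intro b hb
    by_contra! hle
    exact wormLT_irrefl ξ A ((wormLT_of_mem hB' hb fun a ha => (hμ a ha).trans_le hle).trans
      ((WormLE.append_left B s).trans_lt hB))
  lift B to List (Set.Iio μ) using hlt
  exact ⟨B, rfl⟩

theorem isLUB_Omega (ξ : Ordinal.{u}) (A : Worm.{u}) :
    IsLUB {o : Ordinal.{u} | ∃ B : Worm.{u}, wormLT ξ B A ∧ o = Omega ξ B + 1} (Omega ξ A) := by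
  rw [Omega_eq (wormLT_wellFounded ξ) A]
  exact isLUB_csSup' (bddAbove_Omega ξ A)

theorem Omega_lt {ξ : Ordinal.{u}} {A B : Worm.{u}} (h : wormLT ξ B A) :
    Omega ξ B < Omega ξ A :=
  Order.add_one_le_iff.1 ((isLUB_Omega ξ A).1 ⟨B, h, rfl⟩)

/-- Ω_ξ skips no values: η is at most Ω_ξ(B) for some predecessor B, and one descends. This supplies
worms with prescribed exponents. -/
theorem exists_Omega_eq {ξ η : Ordinal.{u}} {A : Worm.{u}} (h : η < Omega ξ A) :
    ∃ B, wormLT ξ B A ∧ Omega ξ B = η := by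
  induction A using (wormLT_wellFounded ξ).induction with
  | _ A ih =>
    obtain ⟨_, ⟨B, hB, rfl⟩, hlt⟩ := (lt_isLUB_iff (isLUB_Omega ξ A)).1 h
    rcases (Order.lt_add_one_iff.1 hlt).eq_or_lt with rfl | hlt
    · exact ⟨B, hB, rfl⟩
    · obtain ⟨C, hC, rfl⟩ := ih B hB hlt
      exact ⟨C, hC.trans hB, rfl⟩

theorem Omega_mono {ξ : Ordinal.{u}} {A B : Worm.{u}} (h : WormLE B A) :
    Omega ξ B ≤ Omega ξ A := by
  refine (isLUB_Omega ξ B).2 ?_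
  rintro _ ⟨C, hC, rfl⟩
  exact Order.add_one_le_iff.2 (Omega_lt (hC.trans_le h))

theorem exists_above_Omega_eq {ξ η : Ordinal.{u}} {A : Worm.{u}} (h : η < Omega ξ A) :
    ∃ B, Above ξ B ∧ wormLT ξ B A ∧ Omega ξ B = η := by
  obtain ⟨B, hB, rfl⟩ := exists_Omega_eq h
  obtain ⟨B, s, rfl, hB', hs⟩ := exists_append ξ B
  exact ⟨B, hB', (WormLE.append_left B s).trans_lt hB, (Omega_append hB' s hs).symm⟩

theorem add_opow_lt {a b x y : Ordinal.{u}} (ha : a < b + ω ^ x) (hy : y < x) :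
    a + ω ^ y < b + ω ^ x := by
  have hp : (ω : Ordinal.{u}) ^ y < ω ^ x := (opow_lt_opow_iff_right one_lt_omega0).2 hy
  rcases le_total a b with h | h
  · calc a + ω ^ y ≤ b + ω ^ y := by gcongr
      _ < b + ω ^ x := (add_lt_add_iff_left b).2 hp
  · obtain ⟨δ, rfl⟩ := exists_add_of_le h
    rw [add_assoc, add_lt_add_iff_left]
    exact isPrincipal_add_omega0_opow x ((add_lt_add_iff_left b).1 ha) hp

theorem exists_lt_opow_mul_nat {η x : Ordinal.{u}} (hx : x ≠ 0) (h : η < ω ^ x) :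
    ∃ y < x, ∃ n : ℕ, η < ω ^ y * n := by
  rcases eq_or_ne η 0 with rfl | hη
  · exact ⟨0, pos_iff_ne_zero.2 hx, 1, by simp⟩
  refine ⟨log ω η, (lt_opow_iff_log_lt one_lt_omega0 hη).1 h, ?_⟩
  obtain ⟨n, hn⟩ := lt_omega0.1 (div_opow_log_lt η one_lt_omega0)
  refine ⟨n + 1, ?_⟩
  have := lt_mul_succ_div η (opow_pos (log ω η) omega0_pos).ne'
  rw [hn] at this
  simpa using this

/-- The order type of `A ξ C`, where all letters of `A` are greater than `ξ`. -/
theorem Omega_append_cons {ξ : Ordinal.{u}} {A C : Worm.{u}} (hA : Above (ξ + 1) A)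
    (hC : Above ξ C) :
    Omega ξ (A ++ ξ :: C) = Omega ξ C + ω ^ Omega (ξ + 1) A := by
  induction acc_aboveLT hA generalizing C with
  | intro A _ ih =>
    apply le_antisymm
    -- Upper bound: a predecessor not covered by C has the value of some D plus ω^y, or at most
    -- Ω_ξ(C) + ω^y, with y < Ω_{ξ+1}(A); adding ω^y to something below the bound stays below it.
    · have main : ∀ n (B : Worm.{u}), B.length = n → Above ξ B → wormLT ξ B (A ++ ξ :: C) →
          Omega ξ B < Omega ξ C + ω ^ Omega (ξ + 1) A := by
        have hpos : Omega ξ C < Omega ξ C + ω ^ Omega (ξ + 1) A :=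
          lt_add_of_pos_right _ (opow_pos _ omega0_pos)
        intro n
        induction n using Nat.strong_induction_on with
        | _ n ihn =>
          intro B hn hB hlt
          by_cases hCB : wormLT ξ C B
          · rcases exists_of_lt_append hA hB hCB hlt with
              ⟨hB', hBA, -, hle⟩ | ⟨B₀, D, rfl, hB₀, hD, hBA⟩
            · refine (Omega_mono (WormLE.append_left B (ξ :: C))).trans_lt ?_
              rw [ih B ⟨hB', hBA⟩ hB' hC]
              exact add_opow_lt hpos (Omega_lt hBA)
            · rw [ih B₀ ⟨hB₀, hBA⟩ hB₀ hD]
              refine add_opow_lt (ihn _ ?_ D rfl hD ?_) (Omega_lt hBA)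
              · rw [← hn]; simp; omega
              · exact (wormLT_append_cons hB₀ D).trans hlt
          · rcases WormLE.of_not_lt hC hB hCB with h | h
            · exact (Omega_mono h).trans_lt hpos
            · exact (Omega_lt h).trans hpos
      refine (isLUB_Omega ξ _).2 ?_
      rintro _ ⟨B, hB, rfl⟩
      obtain ⟨B, s, rfl, hB', hs⟩ := exists_append ξ B
      rw [Omega_append hB' s hs, Order.add_one_le_iff]
      exact main _ B rfl hB' ((WormLE.append_left B s).trans_lt hB)
    · have hCA : wormLT ξ C (A ++ ξ :: C) := wormLT_append_cons hA C
      rcases eq_or_ne (Omega (ξ + 1) A) 0 with h0 | h0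
      · rw [h0, opow_zero, Order.add_one_le_iff]
        exact Omega_lt hCA
      · refine le_of_forall_lt fun η hη => ?_
        rcases lt_or_ge η (Omega ξ C) with hlt | hle
        · exact hlt.trans (Omega_lt hCA)
        obtain ⟨δ, rfl⟩ := exists_add_of_le hle
        obtain ⟨y, hy, n, hn⟩ := exists_lt_opow_mul_nat h0 ((add_lt_add_iff_left _).1 hη)
        obtain ⟨B, hB, hBA, rfl⟩ := exists_above_Omega_eq hy
        -- Lower bound: the worms B ξ B ξ … B ξ C with n copies of B all lie below A ξ C.
        have iter : ∀ n : ℕ, ∃ D, Above ξ D ∧ wormLT ξ D (A ++ ξ :: C) ∧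
            Omega ξ D = Omega ξ C + ω ^ Omega (ξ + 1) B * n := by
          intro n
          induction n with
          | zero => exact ⟨C, hC, hCA, by simp⟩
          | succ n ihn =>
            obtain ⟨D, hD, hDA, hn⟩ := ihn
            refine ⟨B ++ ξ :: D, ?_, ?_, ?_⟩
            · exact above_append.2 ⟨hB.mono (lt_add_one ξ).le, above_cons.2 ⟨le_rfl, hD⟩⟩
            · exact (wormLT.append hB (startsBelow_cons.2 (lt_add_one ξ))
                (hBA.trans_le (.append_left _ _)) hDA).of_le (lt_add_one ξ).le
            · rw [ih B ⟨hB, hBA⟩ hB hD, hn, add_assoc, Nat.cast_succ, mul_add_one]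
        obtain ⟨D, -, hD, hDn⟩ := iter n
        calc Omega ξ C + δ < Omega ξ D := by rw [hDn]; exact (add_lt_add_iff_left _).2 hn
          _ < _ := Omega_lt hD

theorem Omega_nil (ξ : Ordinal.{u}) : Omega ξ [] = 0 := by
  by_contra h
  obtain ⟨B, hB, -⟩ := exists_Omega_eq (pos_iff_ne_zero.2 h)
  exact wormLT_irrefl ξ [] ((show WormLE [] B from .to_top _).trans_lt hB)

theorem Omega_add_one_of_above {ξ : Ordinal.{u}} {A : Worm.{u}} (hA : Above ξ A) :
    Omega (ξ + 1) A = endLog (Omega ξ A) := by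
  rcases hA.cases with hA' | ⟨B, C, rfl, hB, hC⟩
  · cases A with
    | nil => rw [Omega_nil, Omega_nil, endLog_zero]
    | cons a A =>
      -- A nonempty worm implies ⟨ξ⟩⊤ here, so it is equivalent to itself followed by ξ, and the
      -- formula applies with C empty.
      have h1 : WormLE [ξ] (a :: A) :=
        Entails.trans (.dia_mono (.to_top _)) (.dia_le (above_cons.1 hA).1 _)
      have h2 : WormLE ((a :: A) ++ [ξ]) (a :: A) :=
        .append hA' (startsBelow_cons.2 (lt_add_one ξ)) (.refl _) h1
      have h3 : Omega ξ (a :: A) = Omega ξ ((a :: A) ++ [ξ]) :=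
        le_antisymm (Omega_mono (WormLE.append_left _ _)) (Omega_mono h2)
      rw [h3, Omega_append_cons hA' (above_nil ξ), endLog_add_opow]
  · rw [Omega_append_cons hB hC, endLog_add_opow,
      Omega_append hB _ (startsBelow_cons.2 (lt_add_one ξ))]

end GLP

theorem mainTheorem3 :
    (∀ ξ : Ordinal.{u}, WellFounded (GLP.wormLT.{u} ξ)) ∧
    (∀ (ξ : Ordinal.{u}) (A : GLP.Worm.{u}),
      IsLUB {o : Ordinal.{u} | ∃ B : GLP.Worm.{u}, GLP.wormLT ξ B A ∧ o = GLP.Omega ξ B + 1}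
        (GLP.Omega ξ A)) ∧
    (∀ (A : GLP.Worm.{u}) (ξ : Ordinal.{u}),
      GLP.Omega (ξ + 1) A = GLP.endLog (GLP.Omega ξ A)) := by
  refine ⟨GLP.wormLT_wellFounded, GLP.isLUB_Omega, fun A ξ => ?_⟩
  obtain ⟨A, r, rfl, hA, hr⟩ := GLP.exists_append ξ A
  rw [GLP.Omega_append hA r hr, ← GLP.Omega_add_one_of_above hA]
  -- It remains to discard r at level ξ + 1: with and without r the head at that level is the same
  -- B, since s followed by r still starts below ξ + 1.
  obtain ⟨B, s, rfl, hB, hs⟩ := GLP.exists_append (ξ + 1) A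
  rw [List.append_assoc, GLP.Omega_append hB s hs,
    GLP.Omega_append hB _ (hs.append (hr.mono (lt_add_one ξ).le))]
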